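/- Let $q\in[1,\infty]$, and equip $\mathbb R^N$ with the norm $\|\cdot\|_q$. Let $\Xi_1,\dots,\Xi_L\subseteq\mathbb R^N$ be Borel sets (the support sets of $L$ modes), $\Xi=\bigcup_{l=1}^L\Xi_l$, and $\mathrm{diam}(\Xi)=\sup\{\|\xi-\xi'\|_q:\xi,\xi'\in\Xi\}\in[0,\infty]$. For a Borel set $A$ let $\mathcal P(A)$ be the set of Borel probability measures on $\mathbb R^N$ concentrated on $A$, and for Borel probability measures $Q_1,Q_2$ on $\mathbb R^N$ let $$\mathcal W_q(Q_1,Q_2)=\inf_{\Pi}\int\|\xi_1-\xi_2\|_q\,\Pi(d\xi_1,d\xi_2)\in[0,\infty]$$ be the type-1 Wasserstein distance, the infimum being over all joint distributions $\Pi$ with marginals $Q_1$ and $Q_2$. Let $\mathcal Y\subseteq\mathbb R^I$ and $c\in\mathbb R^I$. For each $y\in\mathcal Y$ let $\hat p(y)\in\mathbb R_+^L$ with $\sum_{l}\hat p_l(y)=1$ be reference mode probabilities, and for each mode $l$ let $\hat{\mathbb P}_l(y)=\frac1{K_l}\sum_{k=1}^{K_l}\delta_{\hat\xi_{lk}(y)}$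 be the empirical distribution of $K_l\ge1$ sample points $\hat\xi_{lk}(y)\in\mathbb R^N$. Let $\rho\ge0$ and $\epsilon_1,\dots,\epsilon_L\ge0$. Define the multimodal ambiguity set $$\Theta_D(y)=\Big\{\sum_{l=1}^Lp_l\mathbb P_l:\ p\in\mathbb R_+^L,\ \sum_{l=1}^Lp_l=1,\ \sum_{l=1}^L|p_l-\hat p_l(y)|\le\rho,\ \mathbb P_l\in\mathcal P(\Xi_l),\ \mathcal W_q(\mathbb P_l,\hat{\mathbb P}_l(y))\le\epsilon_l\ (l=1,\dots,L)\Big\}$$ and the single-modal ambiguity set $$\Theta_D'(y)=\Big\{\mathbb P\in\mathcal P(\Xi):\ \mathcal W_q\Big(\mathbb P,\sum_{l=1}^L\hat p_l(y)\hat{\mathbb P}_l(y)\Big)\le\sum_{l=1}^L\hat p_l(y)\epsilon_l+\rho\cdot\mathrm{diam}(\Xi)\Big\},$$ where $0\cdot\infty=0$. Let $h(y,\xi)=\inf\{(Q\xi+b)^{\mathsf T}x:\ x\in\mathbb R^J,\ T(y)\xi+Wx\ge R(y)\}\in[-\infty,\infty]$ be the optimal value of the second-stage linear program with given matrices $Q\in\mathbb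 R^{J\times N}$, $W\in\mathbb R^{S\times J}$, a vector $b\in\mathbb R^J$, and functions $T(y)\in\mathbb R^{S\times N}$, $R(y)\in\mathbb R^S$ of $y$. Then $\Theta_D(y)\subseteq\Theta_D'(y)$ for every $y\in\mathcal Y$. Consequently the optimal value of the multimodal model is at most that of the single-modal one: $$\inf_{y\in\mathcal Y}\Big\{c^{\mathsf T}y+\sup_{\mathbb P\in\Theta_D(y)}\mathbb E_{\mathbb P}[h(y,\xi)]\Big\}\le\inf_{y\in\mathcal Y}\Big\{c^{\mathsf T}y+\sup_{\mathbb P\in\Theta_D'(y)}\mathbb E_{\mathbb P}[h(y,\xi)]\Big\},$$ where the values are in $[-\infty,\infty]$ and $\mathbb E_{\mathbb P}[h]=\mathbb E_{\mathbb P}[h^+]-\mathbb E_{\mathbb P}[h^-]$, with value $-\infty$ if both terms are infinite. -/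

import Mathlib

open MeasureTheory
open scoped ENNReal NNReal Matrix

noncomputable section

/-- `P` is a probability distribution supported on `S`, i.e. `P ∈ 𝒫(S)`. -/
def IsDistributionOn {X : Type*} [MeasurableSpace X] (S : Set X) (P : Measure X) : Prop :=
  IsProbabilityMeasure P ∧ P Sᶜ = 0

/-- The type-1 Wasserstein distance for the reference norm of `X`: the infimum of the expected
distance over all joint distributions with marginals `P` and `Q`. It takes values in `[0, ∞]`.
If `P` and `Q` are concentrated on a set, then so is every such joint distribution on its square. -/
def wassersteinOne {X : Type*} [NormedAddCommGroup X] [MeasurableSpace X]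
    (P Q : Measure X) : ℝ≥0∞ :=
  ⨅ (π : Measure (X × X)) (_ : π.map Prod.fst = P) (_ : π.map Prod.snd = Q),
    ∫⁻ z, ‖z.1 - z.2‖ₑ ∂π

/-- The distributions on `S` within type-1 Wasserstein distance `r` of `Q`. -/
def wassersteinBall {X : Type*} [NormedAddCommGroup X] [MeasurableSpace X]
    (S : Set X) (Q : Measure X) (r : ℝ≥0∞) : Set (Measure X) :=
  {P | IsDistributionOn S P ∧ wassersteinOne P Q ≤ r}

/-- The variation distance set of mode probabilities around `pHat`. -/
def variationSet {L : ℕ} (pHat : Fin L → ℝ) (ρ : ℝ≥0) : Set (Fin L → ℝ) :=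
  {p | (∀ l, 0 ≤ p l) ∧ ∑ l, p l = 1 ∧ ∑ l, |p l - pHat l| ≤ (ρ : ℝ)}

/-- The mixture `∑ l, p l • P l`. -/
def mixture {X : Type*} [MeasurableSpace X] {L : ℕ} (p : Fin L → ℝ)
    (P : Fin L → Measure X) : Measure X :=
  ∑ l, ENNReal.ofReal (p l) • P l

/-- The empirical distribution `(1/K) ∑ k, δ_{s k}` of the samples `s`. -/
def empirical {X : Type*} [MeasurableSpace X] {K : ℕ} (s : Fin K → X) : Measure X :=
  (K : ℝ≥0∞)⁻¹ • ∑ k, Measure.dirac (s k)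

/-- The generic multimodal ambiguity set: mixtures with weights in `Δ` of distributions in `U l`. -/
def multimodalSet {X : Type*} [MeasurableSpace X] {L : ℕ} (Δ : Set (Fin L → ℝ))
    (U : Fin L → Set (Measure X)) : Set (Measure X) :=
  {μ | ∃ p ∈ Δ, ∃ P : Fin L → Measure X, (∀ l, P l ∈ U l) ∧ μ = mixture p P}

/-- The multimodal distance-based ambiguity set at a fixed first-stage decision: variation distance
set for the modes, Wasserstein balls of radius `ε l` on `Ξ l` around `PHat l` for each mode. -/
def multimodalDistanceSet {X : Type*} [NormedAddCommGroup X] [MeasurableSpace X] {L : ℕ}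
    (Ξ : Fin L → Set X) (ε : Fin L → ℝ≥0) (ρ : ℝ≥0)
    (pHat : Fin L → ℝ) (PHat : Fin L → Measure X) : Set (Measure X) :=
  multimodalSet (variationSet pHat ρ) (fun l => wassersteinBall (Ξ l) (PHat l) (ε l))

/-- The single-modal distance-based ambiguity set at a fixed first-stage decision. The radius lies
in `[0, ∞]`, with the convention `0 * ∞ = 0` when `ρ = 0` and the support is unbounded. -/
def singleModalDistanceSet {X : Type*} [NormedAddCommGroup X] [MeasurableSpace X] {L : ℕ}
    (Ξ : Fin L → Set X) (ε : Fin L → ℝ≥0) (ρ : ℝ≥0)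
    (pHat : Fin L → ℝ) (PHat : Fin L → Measure X) : Set (Measure X) :=
  wassersteinBall (⋃ l, Ξ l) (mixture pHat PHat)
    (∑ l, ENNReal.ofReal (pHat l) * (ε l : ℝ≥0∞) + (ρ : ℝ≥0∞) * Metric.ediam (⋃ l, Ξ l))

/-- The second-stage cost `h(y, ξ)`: the optimal value, in `[-∞, ∞]`, of
`min (Q ξ + b)ᵀ x` subject to `T(y) ξ + W x ≥ R(y)`, for fixed `T = T(y)` and `R = R(y)`. -/
def secondStage {N J S : ℕ} (Q : Matrix (Fin J) (Fin N) ℝ) (b : Fin J → ℝ)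
    (W : Matrix (Fin S) (Fin J) ℝ) (T : Matrix (Fin S) (Fin N) ℝ) (R : Fin S → ℝ)
    (ξ : Fin N → ℝ) : EReal :=
  ⨅ (x : Fin J → ℝ) (_ : R ≤ T *ᵥ ξ + W *ᵥ x), (((Q *ᵥ ξ + b) ⬝ᵥ x : ℝ) : EReal)

/-- The expectation `E[f⁺] - E[f⁻]` in `[-∞, ∞]`. If both parts are infinite, so that the
expectation is undefined, the value is `-∞`: such a distribution never counts in a supremum. -/
def extExpectation {X : Type*} [MeasurableSpace X] (P : Measure X) (f : X → EReal) : EReal :=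
  ((∫⁻ ξ, (f ξ).toENNReal ∂P : ℝ≥0∞) : EReal) - ((∫⁻ ξ, (-f ξ).toENNReal ∂P : ℝ≥0∞) : EReal)

/-- The optimal value of `min_{y ∈ Y} cᵀ y + max_{P ∈ Θ(y)} E_P[h(y, ξ)]`. -/
def droValue {X : Type*} [MeasurableSpace X] {I : ℕ} (Y : Set (Fin I → ℝ)) (c : Fin I → ℝ)
    (h : (Fin I → ℝ) → X → EReal) (Θ : (Fin I → ℝ) → Set (Measure X)) : EReal :=
  ⨅ y ∈ Y, (((c ⬝ᵥ y : ℝ) : EReal) + ⨆ P ∈ Θ y, extExpectation P (h y))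

end

/-! Split the weights as `p = m + a` and `pHat = m + b` with `m = min p pHat`; then `a` and `b` have
the same total mass, at most `ρ`. Given near-optimal couplings `π l` of `P l` with `PHat l`,
transport the common part `m l` by `π l`. The excess `∑ l, a l • P l` must be sent to `∑ l, b l •
PHat l`, across modes: first move to the first marginal `∑ l, b l • P l`, at a cost of at most the
diameter per unit of mass, then follow `π l`. In total `π l` is used with weight `m l + b l = pHat
l`, which gives the radius `∑ l, pHat l * ε l + ρ * diam`. The detour goes through points of the `P
l`, so the samples behind `PHat l` may lie outside the support. The inequality of optimal values is
then monotonicity of the supremum, valid for any cost function. -/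

open Measure in
/-- Two finite measures of equal mass, the first concentrated on `S`, the second the second marginal
of a measure `β` whose first marginal is concentrated on `S`, have a coupling whose cost exceeds
that of `β` by at most the common mass times the diameter of `S`. -/
theorem exists_coupling_le_mass_mul_ediam_add {X : Type*} [NormedAddCommGroup X]
    [MeasurableSpace X] [BorelSpace X] [SecondCountableTopology X] {S : Set X}
    (A : Measure X) (β : Measure (X × X)) [IsFiniteMeasure A] [IsFiniteMeasure β]
    (hmass : A Set.univ = β Set.univ) (hA : ∀ᵐ x ∂A, x ∈ S) (hβ : ∀ᵐ z ∂β, z.1 ∈ S) :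
    ∃ γ : Measure (X × X), γ.map Prod.fst = A ∧ γ.map Prod.snd = β.map Prod.snd ∧
      ∫⁻ z, ‖z.1 - z.2‖ₑ ∂γ ≤ A Set.univ * Metric.ediam S + ∫⁻ z, ‖z.1 - z.2‖ₑ ∂β := by
  -- The coupling below is normalised by the inverse of the mass, so zero mass is treated apart.
  rcases eq_or_ne (A Set.univ) 0 with h0 | h0
  · have hA0 : A = 0 := measure_univ_eq_zero.1 h0
    have hβ0 : β = 0 := measure_univ_eq_zero.1 (hmass ▸ h0)
    exact ⟨0, by simp [hA0, hβ0]⟩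
  have htop : A Set.univ ≠ ∞ := measure_ne_top A _
  have hg : Measurable (fun z : X × X × X => (z.1, z.2.2)) := by fun_prop
  have hcost : Measurable (fun z : X × X => ‖z.1 - z.2‖ₑ) := by fun_prop
  have hfst : (A.prod β).map Prod.fst = A Set.univ • A := by
    rw [map_fst_prod, hmass]
  have hsnd : (A.prod β).map Prod.snd = A Set.univ • β := map_snd_prod
  have hcancel := ENNReal.inv_mul_cancel h0 htop
  -- Draw `x` from `A` and `(x', y)` from `β` independently, and keep `(x, y)`. The intermediate
  -- point `x'` lies in `S`, as `x` does, so the leg from `x` to `x'` costs at most the diameter.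
  refine ⟨(A Set.univ)⁻¹ • (A.prod β).map (fun z => (z.1, z.2.2)), ?_, ?_, ?_⟩
  · rw [Measure.map_smul, map_map measurable_fst hg]
    change _ • (A.prod β).map Prod.fst = A
    rw [hfst, smul_smul, hcancel, one_smul]
  · rw [Measure.map_smul, map_map measurable_snd hg]
    change _ • (A.prod β).map (Prod.snd ∘ Prod.snd) = _
    rw [← map_map measurable_snd measurable_snd, hsnd, Measure.map_smul, smul_smul, hcancel,
      one_smul]
  · have hA' : ∀ᵐ z ∂A.prod β, z.1 ∈ S := quasiMeasurePreserving_fst.ae hA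
    have hβ' : ∀ᵐ z ∂A.prod β, z.2.1 ∈ S := quasiMeasurePreserving_snd.ae hβ
    have hbound : ∫⁻ z, ‖z.1 - z.2.2‖ₑ ∂A.prod β ≤
        ∫⁻ z, (Metric.ediam S + ‖z.2.1 - z.2.2‖ₑ) ∂A.prod β := by
      refine lintegral_mono_ae ?_
      filter_upwards [hA', hβ'] with z h₁ h₂
      calc ‖z.1 - z.2.2‖ₑ = ‖(z.1 - z.2.1) + (z.2.1 - z.2.2)‖ₑ := by rw [sub_add_sub_cancel]
        _ ≤ ‖z.1 - z.2.1‖ₑ + ‖z.2.1 - z.2.2‖ₑ := enorm_add_le _ _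
        _ ≤ _ := by
          gcongr
          rw [← edist_eq_enorm_sub]
          exact Metric.edist_le_ediam_of_mem h₁ h₂
    have hlast : ∫⁻ z, ‖z.2.1 - z.2.2‖ₑ ∂A.prod β =
        A Set.univ * ∫⁻ z, ‖z.1 - z.2‖ₑ ∂β := by
      rw [← lintegral_map (f := fun w : X × X => ‖w.1 - w.2‖ₑ) hcost measurable_snd, hsnd,
        lintegral_smul_measure, smul_eq_mul]
    have huniv : (A.prod β) Set.univ = A Set.univ * A Set.univ := by
      rw [← Set.univ_prod_univ, prod_prod, hmass]
    rw [lintegral_smul_measure, lintegral_map hcost hg, smul_eq_mul]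
    calc (A Set.univ)⁻¹ * ∫⁻ z, ‖z.1 - z.2.2‖ₑ ∂A.prod β
        ≤ (A Set.univ)⁻¹ * (Metric.ediam S * (A Set.univ * A Set.univ) +
            A Set.univ * ∫⁻ z, ‖z.1 - z.2‖ₑ ∂β) := by
          gcongr
          rw [lintegral_add_left measurable_const, lintegral_const, hlast, huniv] at hbound
          exact hbound
      _ = ((A Set.univ)⁻¹ * A Set.univ) *
            (A Set.univ * Metric.ediam S + ∫⁻ z, ‖z.1 - z.2‖ₑ ∂β) := by ring
      _ = _ := by rw [hcancel, one_mul]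

/-- A distance below `r` is witnessed by a coupling of cost below `r`. -/
theorem exists_coupling_lt_of_wassersteinOne_lt {X : Type*} [NormedAddCommGroup X]
    [MeasurableSpace X] {P Q : Measure X} {r : ℝ≥0∞} (h : wassersteinOne P Q < r) :
    ∃ π : Measure (X × X), π.map Prod.fst = P ∧ π.map Prod.snd = Q ∧
      ∫⁻ z, ‖z.1 - z.2‖ₑ ∂π < r := by
  simpa only [wassersteinOne, iInf_lt_iff, exists_prop] using h

/-- The distance of two measures is at most the cost of any coupling. -/
theorem wassersteinOne_le_of_coupling {X : Type*} [NormedAddCommGroup X]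
    [MeasurableSpace X] {P Q : Measure X} (π : Measure (X × X)) (hP : π.map Prod.fst = P)
    (hQ : π.map Prod.snd = Q) : wassersteinOne P Q ≤ ∫⁻ z, ‖z.1 - z.2‖ₑ ∂π :=
  iInf_le_of_le π (iInf_le_of_le hP (iInf_le_of_le hQ le_rfl))

/-- Couplings of the components of two mixtures, with weights `m l + a l` and `m l + b l`, give a
bound on the distance of the mixtures: the excess mass `∑ l, a l` travels at most the diameter of
the support more than the components do. -/
theorem wassersteinOne_sum_smul_le {X ι : Type*} [Fintype ι] [NormedAddCommGroup X]
    [MeasurableSpace X] [BorelSpace X] [SecondCountableTopology X] {S : Set X}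
    (m a b : ι → ℝ≥0∞) (ha : ∀ l, a l ≠ ∞) (hb : ∀ l, b l ≠ ∞) (hab : ∑ l, a l = ∑ l, b l)
    (P Q : ι → Measure X) [∀ l, IsProbabilityMeasure (P l)] (hP : ∀ l, ∀ᵐ x ∂P l, x ∈ S)
    (π : ι → Measure (X × X)) (hfst : ∀ l, (π l).map Prod.fst = P l)
    (hsnd : ∀ l, (π l).map Prod.snd = Q l) :
    wassersteinOne (∑ l, (m l + a l) • P l) (∑ l, (m l + b l) • Q l) ≤
      ∑ l, (m l + b l) * ∫⁻ z, ‖z.1 - z.2‖ₑ ∂π l + (∑ l, a l) * Metric.ediam S := by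
  have hπ (l : ι) : π l Set.univ = 1 := by
    rw [← Set.preimage_univ (f := (Prod.fst : X × X → X)),
      ← Measure.map_apply measurable_fst MeasurableSet.univ, hfst, measure_univ]
  have hmap {Y : Type _} [MeasurableSpace Y] (f : X × X → Y) (hf : Measurable f) (w : ι → ℝ≥0∞) :
      (∑ l, w l • π l).map f = ∑ l, w l • (π l).map f := by
    rw [Measure.map_finset_sum hf.aemeasurable]
    simp only [Measure.map_smul]
  have hA : (∑ l, a l • P l) Set.univ = ∑ l, a l := by simp
  have hB : (∑ l, b l • π l) Set.univ = ∑ l, b l := by simp [hπ]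
  have : IsFiniteMeasure (∑ l, a l • P l) :=
    ⟨by rw [hA]; exact ENNReal.sum_lt_top.2 fun l _ => (ha l).lt_top⟩
  have : IsFiniteMeasure (∑ l, b l • π l) :=
    ⟨by rw [hB]; exact ENNReal.sum_lt_top.2 fun l _ => (hb l).lt_top⟩
  have hπS (l : ι) : ∀ᵐ z ∂π l, z.1 ∈ S :=
    ae_of_ae_map measurable_fst.aemeasurable (by rw [hfst]; exact hP l)
  obtain ⟨γ, hγ₁, hγ₂, hγ⟩ := exists_coupling_le_mass_mul_ediam_add (S := S)
    (∑ l, a l • P l) (∑ l, b l • π l) (by rw [hA, hB, hab])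
    (by
      rw [ae_iff, Measure.finsetSum_apply]
      exact Finset.sum_eq_zero fun l _ => by
        rw [Measure.smul_apply, ae_iff.1 (hP l), smul_zero])
    (by
      rw [ae_iff, Measure.finsetSum_apply]
      exact Finset.sum_eq_zero fun l _ => by
        rw [Measure.smul_apply, ae_iff.1 (hπS l), smul_zero])
  -- The common mass stays within its mode; `γ` carries the excess.
  refine (wassersteinOne_le_of_coupling (∑ l, m l • π l + γ) ?_ ?_).trans ?_
  · rw [Measure.map_add _ _ measurable_fst, hmap _ measurable_fst, hγ₁, ← Finset.sum_add_distrib]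
    simp only [hfst, add_smul]
  · rw [Measure.map_add _ _ measurable_snd, hmap _ measurable_snd, hγ₂, hmap _ measurable_snd,
      ← Finset.sum_add_distrib]
    simp only [hsnd, add_smul]
  · rw [lintegral_add_measure, lintegral_finsetSum_measure]
    rw [hA, lintegral_finsetSum_measure] at hγ
    simp only [lintegral_smul_measure, smul_eq_mul] at hγ ⊢
    refine (add_le_add le_rfl hγ).trans_eq ?_
    simp only [add_mul, Finset.sum_add_distrib]
    ring

/-- For probability vectors, the mass by which `p` exceeds `r` is at most their variation
distance and equals the mass by which `r` exceeds `p`. -/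
theorem sum_sub_min_eq_and_le {ι : Type*} [Fintype ι] (p r : ι → ℝ) (h : ∑ l, p l = ∑ l, r l) :
    ∑ l, (p l - min (p l) (r l)) = ∑ l, (r l - min (p l) (r l)) ∧
      ∑ l, (p l - min (p l) (r l)) ≤ ∑ l, |p l - r l| := by
  refine ⟨by simp only [Finset.sum_sub_distrib, h], Finset.sum_le_sum fun l _ => ?_⟩
  rcases le_total (p l) (r l) with hl | hl
  · rw [min_eq_left hl, sub_self]
    exact abs_nonneg _
  · rw [min_eq_right hl]
    exact le_abs_self _

/-- The multimodal distance-based ambiguity set is contained in the single-modal one. -/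
theorem multimodalDistanceSet_subset_singleModalDistanceSet {X : Type*} [NormedAddCommGroup X]
    [MeasurableSpace X] [BorelSpace X] [SecondCountableTopology X] {L : ℕ}
    (Ξ : Fin L → Set X) (ε : Fin L → ℝ≥0) (ρ : ℝ≥0) (pHat : Fin L → ℝ) (PHat : Fin L → Measure X)
    (hnonneg : ∀ l, 0 ≤ pHat l) (hsum : ∑ l, pHat l = 1) :
    multimodalDistanceSet Ξ ε ρ pHat PHat ⊆ singleModalDistanceSet Ξ ε ρ pHat PHat := by
  rintro _ ⟨p, ⟨hp0, hp1, hpρ⟩, P, hP, rfl⟩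
  have hprob (l : Fin L) : IsProbabilityMeasure (P l) := (hP l).1.1
  have hsupp (l : Fin L) : P l (⋃ l, Ξ l)ᶜ = 0 :=
    measure_mono_null (Set.compl_subset_compl.2 (Set.subset_iUnion Ξ l)) (hP l).1.2
  have hofReal (w : Fin L → ℝ) (hw0 : ∀ l, 0 ≤ w l) (hw1 : ∑ l, w l = 1) :
      ∑ l, ENNReal.ofReal (w l) = 1 := by
    rw [← ENNReal.ofReal_sum_of_nonneg fun l _ => hw0 l, hw1, ENNReal.ofReal_one]
  refine ⟨⟨⟨?_⟩, ?_⟩, ?_⟩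
  · simp [mixture, hofReal p hp0 hp1]
  · simp [mixture, hsupp, -Set.compl_iUnion]
  -- The infimum over couplings need not be known to be attained, so each mode gets slack `η`; as
  -- `pHat` sums to one, the total slack is again `η`.
  refine ENNReal.le_of_forall_pos_le_add fun η hη _ => ?_
  have hη' : (η : ℝ≥0∞) ≠ 0 := by exact_mod_cast hη.ne'
  choose π hfst hsnd hcost using fun l => exists_coupling_lt_of_wassersteinOne_lt
    ((hP l).2.trans_lt (ENNReal.lt_add_right ENNReal.coe_ne_top hη'))
  set m : Fin L → ℝ := fun l => min (p l) (pHat l)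
  have hm0 (l : Fin L) : 0 ≤ m l := le_min (hp0 l) (hnonneg l)
  have ha0 (l : Fin L) : 0 ≤ p l - m l := sub_nonneg.2 (min_le_left _ _)
  have hb0 (l : Fin L) : 0 ≤ pHat l - m l := sub_nonneg.2 (min_le_right _ _)
  obtain ⟨hmass, hle⟩ := sum_sub_min_eq_and_le p pHat (hp1.trans hsum.symm)
  have hpa (l : Fin L) : ENNReal.ofReal (m l) + ENNReal.ofReal (p l - m l) =
      ENNReal.ofReal (p l) := by
    rw [← ENNReal.ofReal_add (hm0 l) (ha0 l), add_sub_cancel]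
  have hpb (l : Fin L) : ENNReal.ofReal (m l) + ENNReal.ofReal (pHat l - m l) =
      ENNReal.ofReal (pHat l) := by
    rw [← ENNReal.ofReal_add (hm0 l) (hb0 l), add_sub_cancel]
  have key := wassersteinOne_sum_smul_le (S := ⋃ l, Ξ l) (fun l => ENNReal.ofReal (m l))
    (fun l => ENNReal.ofReal (p l - m l)) (fun l => ENNReal.ofReal (pHat l - m l))
    (fun _ => ENNReal.ofReal_ne_top) (fun _ => ENNReal.ofReal_ne_top)
    (by
      rw [← ENNReal.ofReal_sum_of_nonneg fun l _ => ha0 l,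
        ← ENNReal.ofReal_sum_of_nonneg fun l _ => hb0 l, hmass])
    P PHat (fun l => mem_ae_iff.2 (hsupp l)) π hfst hsnd
  simp only [hpa, hpb] at key
  -- The excess is in fact half the variation distance; the cruder bound by `ρ` suffices for the
  -- stated radius.
  have hexcess : ∑ l, ENNReal.ofReal (p l - m l) ≤ ρ := by
    rw [← ENNReal.ofReal_sum_of_nonneg fun l _ => ha0 l]
    exact ENNReal.ofReal_le_of_le_toReal (hle.trans hpρ)
  calc wassersteinOne (mixture p P) (mixture pHat PHat) ≤ _ := key
    _ ≤ ∑ l, ENNReal.ofReal (pHat l) * ((ε l : ℝ≥0∞) + η) + ρ * Metric.ediam (⋃ l, Ξ l) := by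
      gcongr with l
      exact (hcost l).le
    _ = _ := by
      simp only [mul_add, Finset.sum_add_distrib, ← Finset.sum_mul, hofReal pHat hnonneg hsum]
      ring

/-- Enlarging the ambiguity sets can only increase the optimal value. -/
theorem droValue_mono {X : Type*} [MeasurableSpace X] {I : ℕ} (Y : Set (Fin I → ℝ))
    (c : Fin I → ℝ) (h : (Fin I → ℝ) → X → EReal) {Θ Θ' : (Fin I → ℝ) → Set (Measure X)}
    (hΘ : ∀ y ∈ Y, Θ y ⊆ Θ' y) : droValue Y c h Θ ≤ droValue Y c h Θ' :=
  iInf₂_mono fun y hy => add_le_add le_rfl (biSup_mono fun _ hP => hΘ y hy hP)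

theorem theorem11 {I N J S L : ℕ} (q : ℝ≥0∞) [Fact (1 ≤ q)]
    (Y : Set (Fin I → ℝ)) (c : Fin I → ℝ)
    (Q : Matrix (Fin J) (Fin N) ℝ) (b : Fin J → ℝ) (W : Matrix (Fin S) (Fin J) ℝ)
    (T : (Fin I → ℝ) → Matrix (Fin S) (Fin N) ℝ) (R : (Fin I → ℝ) → Fin S → ℝ)
    (Ξ : Fin L → Set (PiLp q (fun _ : Fin N => ℝ))) (hΞ : ∀ l, MeasurableSet (Ξ l))
    (K : Fin L → ℕ) (hK : ∀ l, 0 < K l)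
    (ξHat : (l : Fin L) → Fin (K l) → (Fin I → ℝ) → PiLp q (fun _ : Fin N => ℝ))
    (pHat : (Fin I → ℝ) → Fin L → ℝ)
    (hp_nonneg : ∀ y ∈ Y, ∀ l, 0 ≤ pHat y l) (hp_sum : ∀ y ∈ Y, ∑ l, pHat y l = 1)
    (ε : Fin L → ℝ≥0) (ρ : ℝ≥0) :
    (∀ y ∈ Y,
      multimodalDistanceSet Ξ ε ρ (pHat y) (fun l => empirical (fun k => ξHat l k y)) ⊆
        singleModalDistanceSet Ξ ε ρ (pHat y) (fun l => empirical (fun k => ξHat l k y))) ∧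
    droValue Y c (fun y ξ => secondStage Q b W (T y) (R y) (WithLp.ofLp ξ))
        (fun y =>
          multimodalDistanceSet Ξ ε ρ (pHat y) (fun l => empirical (fun k => ξHat l k y))) ≤
      droValue Y c (fun y ξ => secondStage Q b W (T y) (R y) (WithLp.ofLp ξ))
        (fun y =>
          singleModalDistanceSet Ξ ε ρ (pHat y) (fun l => empirical (fun k => ξHat l k y))) := by
  have hsub (y) (hy : y ∈ Y) := multimodalDistanceSet_subset_singleModalDistanceSet Ξ ε ρ (pHat y)
    (fun l => empirical (fun k => ξHat l k y)) (hp_nonneg y hy) (hp_sum y hy)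
  exact ⟨hsub, droValue_mono Y c _ hsub⟩
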